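/- Let $(R,\mathfrak m,k)$ be a Noetherian local ring with infinite residue field $k$, let $S=R[z_1,\dots,z_t]$ be a polynomial ring over $R$ ($t\ge 0$), let $M$ be a finite $R$-module and $M'=M\otimes_R S$, and let $N'\subseteq M'$ be an $S$-submodule. Write $\lambda$ for length. For $\alpha=(\alpha_1,\dots,\alpha_t)\in R^t$ the specialization of a finite $S$-module $P$ with a finite free presentation $S^f\xrightarrow{A}S^g\to P\to 0$ is $P_\alpha=\operatorname{Coker}(A_\alpha:R^f\to R^g)$, where $A_\alpha$ is obtained from the matrix $A$ by substituting $\alpha$ for $z=(z_1,\dots,z_t)$ in its entries. One has $M'_\alpha=M$, by evaluating at $z=\alpha$. In $\lambda_R(M/N'_\alpha)$ the specialization $N'_\alpha$ is regarded in $M$, i.e. it is replaced by its image under the map $N'_\alpha\to M'_\alpha=M$ induced by the inclusion $N'\subseteq M'$ (this image does not depend on the presentation of $N'$). A property holds for a general vector $\alpha\in R^t$ if there is a Zariski dense open subset $U\subseteq k^t$ such that it holds for every $\alpha\in R^t$ whose image $\overline{\alpha}\in k^t$ lies in $U$. Assume that $\lambda_{S_{\mathfrak mS}}(M'_{\mathfrak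 mS}/N'_{\mathfrak mS})=\delta$ is a non-negative integer. Then: (a) For a general vector $\alpha\in R^t$ one has $\lambda_R(M/N'_\alpha)=\delta$. (b) Assume that $R$ is equicharacteristic (i.e. $\operatorname{char}R=\operatorname{char}k$) and fix any vector $\alpha_0\in R^t$. Then for a general vector $\alpha\in R^t$ one has $\delta=\lambda_R(M/N'_\alpha)\le\lambda_R(M/N'_{\alpha_0})$, where the right-hand side may be infinite. -/

import Mathlib

open scoped TensorProduct Topology

namespace SpecializationLemma

/-! ### Zariski topology on affine space and general vectors -/

theorem zeroLocus_union {k : Type*} [Field k] {t : ℕ} (I J : Ideal (MvPolynomial (Fin t) k)) :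
    MvPolynomial.zeroLocus k I ∪ MvPolynomial.zeroLocus k J =
      MvPolynomial.zeroLocus k (I * J) := by
  apply Set.Subset.antisymm
  · apply Set.union_subset
    · exact MvPolynomial.zeroLocus_anti_mono Ideal.mul_le_left
    · exact MvPolynomial.zeroLocus_anti_mono Ideal.mul_le_right
  · intro x hx
    by_contra hcon
    rw [Set.mem_union, not_or, MvPolynomial.mem_zeroLocus_iff,
      MvPolynomial.mem_zeroLocus_iff] at hcon
    push Not at hcon
    obtain ⟨⟨p, hp, hpx⟩, q, hq, hqx⟩ := hcon
    have h := hx (p * q) (Ideal.mul_mem_mul hp hq)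
    rw [map_mul] at h
    exact (mul_ne_zero hpx hqx) h

/-- The Zariski topology on `k^t`: the closed sets are the common zero loci of families of
polynomials in `k[z₁, …, z_t]`. -/
@[reducible]
def zariskiTopology (k : Type*) [Field k] (t : ℕ) : TopologicalSpace (Fin t → k) :=
  TopologicalSpace.ofClosed
    {Z | ∃ I : Ideal (MvPolynomial (Fin t) k), Z = MvPolynomial.zeroLocus k I}
    ⟨⊤, by simp⟩
    (by
      intro A hA
      refine ⟨Ideal.span {p | ∃ I : Ideal (MvPolynomial (Fin t) k),
        MvPolynomial.zeroLocus k I ∈ A ∧ p ∈ I}, ?_⟩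
      rw [MvPolynomial.zeroLocus_span]
      ext x
      constructor
      · rintro hx p ⟨I, hI, hp⟩
        exact hx _ hI p hp
      · intro hx Z hZ
        obtain ⟨I, rfl⟩ := hA hZ
        exact fun p hp => hx p ⟨I, hZ, hp⟩)
    (by
      rintro _ ⟨I, rfl⟩ _ ⟨J, rfl⟩
      exact ⟨I * J, zeroLocus_union I J⟩)

/-- A property `P` holds for a general vector `α ∈ R^t`: there is a Zariski dense open subset `U`
of `k^t`, where `k` is the residue field of `R`, such that `P α` holds for every `α ∈ R^t` whose
image in `k^t` lies in `U`. -/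
def ForGeneral {R : Type*} [CommRing R] [IsLocalRing R] {t : ℕ}
    (P : (Fin t → R) → Prop) : Prop :=
  ∃ U : Set (Fin t → IsLocalRing.ResidueField R),
    IsOpen[zariskiTopology (IsLocalRing.ResidueField R) t] U ∧
    @Dense _ (zariskiTopology (IsLocalRing.ResidueField R) t) U ∧
    ∀ α : Fin t → R, (fun i => IsLocalRing.residue R (α i)) ∈ U → P α

/-! ### The prime ideal `𝔪S` of `S = R[z₁, …, z_t]` -/

/-- The ideal `𝔪S` of `S = R[z₁, …, z_t]`. -/
noncomputable def extMax (R : Type*) [CommRing R] [IsLocalRing R] (t : ℕ) : Ideal (MvPolynomial (Fin t) R) :=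
  (IsLocalRing.maximalIdeal R).map MvPolynomial.C

instance extMax_isPrime (R : Type*) [CommRing R] [IsLocalRing R] (t : ℕ) :
    (extMax R t).IsPrime := by
  have e := MvPolynomial.quotientEquivQuotientMvPolynomial (σ := Fin t)
    (IsLocalRing.maximalIdeal R)
  rw [← Ideal.Quotient.isDomain_iff_prime]
  exact (MulEquiv.isDomain _ e.symm.toMulEquiv)

/-- The length `λ_{S_𝔭}(P_𝔭 / N_𝔭)`, for a prime ideal `𝔭` of `S` and a submodule `N ⊆ P`. -/
noncomputable def localLength {S P : Type*} [CommRing S] [AddCommGroup P] [Module S P]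
    (p : Ideal S) [p.IsPrime] (N : Submodule S P) : ℕ∞ :=
  Module.length (Localization.AtPrime p)
    (LocalizedModule p.primeCompl P ⧸ Submodule.localized p.primeCompl N)

/-! ### Specialization of modules -/

/-- A finite free presentation `S^f → S^g → P → 0` of an `S`-module `P`, in which the map
`S^f → S^g` is given by a matrix. -/
structure FreePresentation (S P : Type*) [CommRing S] [AddCommGroup P] [Module S P] where
  f : ℕ
  g : ℕ
  A : Matrix (Fin g) (Fin f) S
  π : (Fin g → S) →ₗ[S] P
  surjective : Function.Surjective π
  exact : LinearMap.range A.mulVecLin = LinearMap.ker π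

/-- A finite module over a Noetherian ring has a finite free presentation. -/
theorem FreePresentation.nonempty (S P : Type*) [CommRing S] [IsNoetherianRing S]
    [AddCommGroup P] [Module S P] [Module.Finite S P] : Nonempty (FreePresentation S P) := by
  obtain ⟨g, π, hπ⟩ := Module.Finite.exists_fin' S P
  obtain ⟨f, ψ, hψ⟩ := Module.Finite.exists_fin' S (LinearMap.ker π)
  refine ⟨⟨f, g, LinearMap.toMatrix' ((LinearMap.ker π).subtype ∘ₗ ψ), π, hπ, ?_⟩⟩
  rw [← Matrix.toLin'_apply', Matrix.toLin'_toMatrix', LinearMap.range_comp,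
    LinearMap.range_eq_top.2 hψ, Submodule.map_top, Submodule.range_subtype]

section

variable {R : Type*} [CommRing R] {t : ℕ}
variable {P : Type*} [AddCommGroup P] [Module (MvPolynomial (Fin t) R) P]
variable {M : Type*} [AddCommGroup M] [Module R M]

/-- The specialized matrix `A_α`, obtained by substituting `α` for `z` in the entries of `A`. -/
noncomputable def FreePresentation.matrixAt (φ : FreePresentation (MvPolynomial (Fin t) R) P)
    (α : Fin t → R) : Matrix (Fin φ.g) (Fin φ.f) R :=
  φ.A.map (MvPolynomial.eval α)

/-- The specialization `P_α = Coker(φ_α)`, where `φ_α : R^f → R^g` is given by `A_α`. -/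
abbrev FreePresentation.Specialization (φ : FreePresentation (MvPolynomial (Fin t) R) P)
    (α : Fin t → R) : Type _ :=
  (Fin φ.g → R) ⧸ LinearMap.range (φ.matrixAt α).mulVecLin

/-- The evaluation `S ⊗ M → M`, `p ⊗ m ↦ p(α) m`. -/
noncomputable def evalTensor (M : Type*) [AddCommGroup M] [Module R M] (α : Fin t → R) :
    MvPolynomial (Fin t) R ⊗[R] M →ₗ[R] M :=
  (TensorProduct.lid R M).toLinearMap ∘ₗ
    LinearMap.rTensor M (MvPolynomial.aeval (R := R) α).toLinearMap

@[simp]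
theorem evalTensor_tmul (α : Fin t → R) (p : MvPolynomial (Fin t) R) (m : M) :
    evalTensor M α (p ⊗ₜ m) = MvPolynomial.eval α p • m := by
  simp [evalTensor, MvPolynomial.aeval_eq_eval]

theorem evalTensor_smul (α : Fin t → R) (p : MvPolynomial (Fin t) R)
    (x : MvPolynomial (Fin t) R ⊗[R] M) :
    evalTensor M α (p • x) = MvPolynomial.eval α p • evalTensor M α x := by
  induction x with
  | zero => simp
  | tmul q m => simp [TensorProduct.smul_tmul', mul_smul]
  | add x y hx hy => simp [smul_add, hx, hy]

/-- The `R`-linear map `R^g → M` that sends the `i`-th basis vector to the value at `α` of the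
image under `h` of the `i`-th generator of `P`. -/
noncomputable def FreePresentation.liftFree (φ : FreePresentation (MvPolynomial (Fin t) R) P)
    (h : P →ₗ[MvPolynomial (Fin t) R] MvPolynomial (Fin t) R ⊗[R] M) (α : Fin t → R) :
    (Fin φ.g → R) →ₗ[R] M :=
  Fintype.linearCombination R (fun i => evalTensor M α (h (φ.π (Pi.single i 1))))

theorem FreePresentation.liftFree_eval (φ : FreePresentation (MvPolynomial (Fin t) R) P)
    (h : P →ₗ[MvPolynomial (Fin t) R] MvPolynomial (Fin t) R ⊗[R] M) (α : Fin t → R)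
    (w : Fin φ.g → MvPolynomial (Fin t) R) :
    φ.liftFree h α (fun i => MvPolynomial.eval α (w i)) = evalTensor M α (h (φ.π w)) := by
  conv_rhs => rw [pi_eq_sum_univ' w]
  simp only [FreePresentation.liftFree, Fintype.linearCombination_apply, map_sum, map_smul,
    evalTensor_smul]

theorem FreePresentation.matrixAt_mulVec (φ : FreePresentation (MvPolynomial (Fin t) R) P)
    (α : Fin t → R) (v : Fin φ.f → MvPolynomial (Fin t) R) :
    (φ.matrixAt α).mulVec (fun j => MvPolynomial.eval α (v j)) =
      fun i => MvPolynomial.eval α (φ.A.mulVec v i) := by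
  ext i
  simp [Matrix.mulVec, dotProduct, FreePresentation.matrixAt]

theorem FreePresentation.range_le_ker_liftFree
    (φ : FreePresentation (MvPolynomial (Fin t) R) P)
    (h : P →ₗ[MvPolynomial (Fin t) R] MvPolynomial (Fin t) R ⊗[R] M) (α : Fin t → R) :
    LinearMap.range (φ.matrixAt α).mulVecLin ≤ LinearMap.ker (φ.liftFree h α) := by
  rintro _ ⟨v, rfl⟩
  have hv : v = fun j => MvPolynomial.eval α (MvPolynomial.C (σ := Fin t) (v j)) := by
    ext j; simp
  have hz : φ.π (φ.A.mulVec fun j => MvPolynomial.C (v j)) = 0 := by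
    rw [← LinearMap.mem_ker, ← φ.exact]
    exact ⟨_, rfl⟩
  rw [LinearMap.mem_ker, Matrix.mulVecLin_apply, hv, φ.matrixAt_mulVec, φ.liftFree_eval, hz]
  simp

/-- The map `P_α → (S ⊗ M)_α = M` induced by an `S`-linear map `h : P → S ⊗ M`. -/
noncomputable def FreePresentation.specializeMap
    (φ : FreePresentation (MvPolynomial (Fin t) R) P)
    (h : P →ₗ[MvPolynomial (Fin t) R] MvPolynomial (Fin t) R ⊗[R] M) (α : Fin t → R) :
    φ.Specialization α →ₗ[R] M :=
  Submodule.liftQ _ (φ.liftFree h α) (φ.range_le_ker_liftFree h α)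

/-- For a submodule `N' ⊆ M' = S ⊗ M` with a finite free presentation `φ`: the specialization
`N'_α` regarded in `M`, that is, the image of `N'_α = Coker(φ_α)` under the map
`N'_α → M'_α = M` induced by the inclusion. -/
noncomputable def FreePresentation.specializedSubmodule
    {N' : Submodule (MvPolynomial (Fin t) R) (MvPolynomial (Fin t) R ⊗[R] M)}
    (φ : FreePresentation (MvPolynomial (Fin t) R) N') (α : Fin t → R) : Submodule R M :=
  LinearMap.range (φ.specializeMap N'.subtype α)

/-! ### Sanity checks -/

/-- `N'_α` in `M` consists of the values at `α` of the elements of `N'`; in particular it does not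
depend on the presentation. -/
theorem FreePresentation.specializedSubmodule_eq_map
    {N' : Submodule (MvPolynomial (Fin t) R) (MvPolynomial (Fin t) R ⊗[R] M)}
    (φ : FreePresentation (MvPolynomial (Fin t) R) N') (α : Fin t → R) :
    φ.specializedSubmodule α = (N'.restrictScalars R).map (evalTensor M α) := by
  rw [FreePresentation.specializedSubmodule, FreePresentation.specializeMap,
    Submodule.range_liftQ]
  ext m
  constructor
  · rintro ⟨v, rfl⟩
    have hv : v = fun j => MvPolynomial.eval α (MvPolynomial.C (σ := Fin t) (v j)) := by
      ext j; simp
    rw [hv, φ.liftFree_eval]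
    exact ⟨_, (φ.π fun j => MvPolynomial.C (v j)).2, rfl⟩
  · rintro ⟨x, hx, rfl⟩
    obtain ⟨w, hw⟩ := φ.surjective ⟨x, hx⟩
    exact ⟨fun i => MvPolynomial.eval α (w i), by rw [φ.liftFree_eval, hw]; rfl⟩

/-- Every element of `S ⊗ M` is congruent to its value at `α` modulo the elements
`∑ (z_i - α_i) y_i`. -/
theorem sub_evalTensor_mem (α : Fin t → R) (x : MvPolynomial (Fin t) R ⊗[R] M) :
    x - (1 : MvPolynomial (Fin t) R) ⊗ₜ[R] evalTensor M α x ∈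
      RingHom.ker (MvPolynomial.eval α) •
        (⊤ : Submodule (MvPolynomial (Fin t) R) (MvPolynomial (Fin t) R ⊗[R] M)) := by
  induction x with
  | zero => simp
  | tmul p m =>
    have : p ⊗ₜ[R] m - (1 : MvPolynomial (Fin t) R) ⊗ₜ[R] evalTensor M α (p ⊗ₜ m) =
        (p - MvPolynomial.C (MvPolynomial.eval α p)) •
          ((1 : MvPolynomial (Fin t) R) ⊗ₜ[R] m) := by
      rw [evalTensor_tmul, ← TensorProduct.smul_tmul, TensorProduct.smul_tmul', smul_eq_mul,
        mul_one, ← TensorProduct.sub_tmul, MvPolynomial.smul_eq_C_mul, mul_one]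
    rw [this]
    exact Submodule.smul_mem_smul (by simp [RingHom.mem_ker]) trivial
  | add x y hx hy =>
    have := add_mem hx hy
    rwa [sub_add_sub_comm, ← TensorProduct.tmul_add, ← map_add] at this

/-- The identification `M'_α = M` for `M' = S ⊗ M`. -/
theorem FreePresentation.specializeMap_id_bijective
    (φ : FreePresentation (MvPolynomial (Fin t) R) (MvPolynomial (Fin t) R ⊗[R] M))
    (α : Fin t → R) :
    Function.Bijective (φ.specializeMap LinearMap.id α) := by
  constructor
  · rw [← LinearMap.ker_eq_bot, FreePresentation.specializeMap, Submodule.ker_liftQ_eq_bot]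
    intro v hv
    have hv' : v = fun j => MvPolynomial.eval α (MvPolynomial.C (σ := Fin t) (v j)) := by
      ext j; simp
    rw [LinearMap.mem_ker, hv', φ.liftFree_eval] at hv
    have hm := sub_evalTensor_mem α (φ.π fun j => MvPolynomial.C (v j))
    rw [show evalTensor M α (φ.π fun j => MvPolynomial.C (v j)) = 0 from hv,
      TensorProduct.tmul_zero, sub_zero, ← LinearMap.range_eq_top.2 φ.surjective,
      ← Submodule.map_top, ← Submodule.map_smul''] at hm
    obtain ⟨w, hw, hwv⟩ := hm
    have hw0 : ∀ i, MvPolynomial.eval α (w i) = 0 := by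
      intro i
      refine Submodule.smul_induction_on hw (fun p hp n _ => ?_) (fun x y hx hy => ?_)
      · simp [RingHom.mem_ker.1 hp]
      · simp [hx, hy]
    have hk : (fun j => MvPolynomial.C (v j)) - w ∈ LinearMap.ker φ.π := by
      rw [LinearMap.mem_ker, map_sub, hwv, sub_self]
    rw [← φ.exact] at hk
    obtain ⟨u, hu⟩ := hk
    refine ⟨fun j => MvPolynomial.eval α (u j), ?_⟩
    rw [Matrix.mulVecLin_apply, φ.matrixAt_mulVec]
    rw [Matrix.mulVecLin_apply] at hu
    ext i
    simp [hu, hw0]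
  · rw [← LinearMap.range_eq_top, FreePresentation.specializeMap, Submodule.range_liftQ,
      eq_top_iff]
    intro m _
    obtain ⟨w, hw⟩ := φ.surjective (1 ⊗ₜ m)
    exact ⟨fun i => MvPolynomial.eval α (w i), by rw [φ.liftFree_eval, hw]; simp⟩

end

end SpecializationLemma

open SpecializationLemma

/-!
Write `S = R[z₁, …, z_t]`, `Q = M' ⧸ N'`, `k` for the residue field, and `I` for the kernel of the
evaluation at a vector `α`. Since `M ⧸ N'_α = Q ⧸ I Q`
(`FreePresentation.length_quotient_specializedSubmodule`), the specialized length is the length of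
the fibre of `Q` at `α`.

The localization of `Q` at the prime `𝔪S` has length `δ`. Lifting simple submodules of the
localization to `Q`, one after the other, gives a submodule `P` of `Q` that is filtered by `δ`
copies of `S ⧸ 𝔪S = k[z]`, and a polynomial `f` outside `𝔪S` with `f Q ⊆ P`
(`exists_hasPrimeFiltration`). Because `𝔪S ∩ Iⁿ = 𝔪S · Iⁿ` (`extMax_inf_ker_eval_pow_le`), reducing
modulo `Iⁿ` keeps the filtration exact, so that `P ⧸ Iⁿ P` has length `δ · H(n)`, where `H(n)` is
the number of monomials of degree less than `n` (`HasPrimeFiltration.length_quotient_ker_eval_pow`).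

If `f(α)` is a unit, then `Q ⧸ I Q = P ⧸ I P` has length `δ · H(1) = δ`. The residue field being
infinite, the condition `f(α) ∉ 𝔪` holds for a general `α`.

For an arbitrary vector, let `l` be the length of `Q ⧸ I Q`. The powers of `I` are generated by
shifted monomials, whence `Q ⧸ Iⁿ Q` has length at most `l · H(n)`. By the Artin–Rees lemma its
length is at least that of `P ⧸ Iⁿ⁻ᶜ P`, which is `δ · H(n - c)`, for a constant `c`. As `H` grows
polynomially, `δ ≤ l` (`HasPrimeFiltration.le_length_quotient_ker_eval`).
-/

namespace SpecializationLemma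

/-! ### Prime filtrations at a prime ideal -/

section Localization

variable {S : Type*} [CommRing S] (p : Ideal S) [p.IsPrime]

theorem exists_notMem_forall_smul_eq_zero {E : Type*} [AddCommGroup E] [Module S E]
    {N : Submodule S E} (hN : N.FG) (h : ∀ x ∈ N, ∃ u ∉ p, u • x = 0) :
    ∃ u ∉ p, ∀ x ∈ N, u • x = 0 := by
  revert h
  induction N, hN using Submodule.fg_induction with
  | singleton x =>
    intro h
    obtain ⟨u, hu, hux⟩ := h x (Submodule.mem_span_singleton_self x)
    refine ⟨u, hu, fun y hy => ?_⟩
    obtain ⟨a, rfl⟩ := Submodule.mem_span_singleton.mp hy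
    rw [smul_comm, hux, smul_zero]
  | sup N₁ N₂ _ _ ih₁ ih₂ =>
    intro h
    obtain ⟨u, hu, hu'⟩ := ih₁ fun x hx => h x (Submodule.mem_sup_left hx)
    obtain ⟨v, hv, hv'⟩ := ih₂ fun x hx => h x (Submodule.mem_sup_right hx)
    refine ⟨u * v, p.primeCompl.mul_mem hu hv, fun x hx => ?_⟩
    obtain ⟨y, hy, z, hz, rfl⟩ := Submodule.mem_sup.mp hx
    rw [smul_add, mul_comm, mul_smul, hu' y hy, mul_comm, mul_smul, hv' z hz, smul_zero,
      smul_zero, add_zero]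

/-- A module whose localization at `p` has positive finite length contains a copy of `S ⧸ p`, and
dividing by it lowers the length of the localization by one. The generator is found in a simple
submodule of the localization. -/
theorem exists_annihilator_eq_prime [IsNoetherianRing S] {E : Type*} [AddCommGroup E] [Module S E]
    {d : ℕ}
    (hd : Module.length (Localization.AtPrime p) (LocalizedModule p.primeCompl E) = d + 1) :
    ∃ e : E, (∀ s : S, s • e = 0 ↔ s ∈ p) ∧
      Module.length (Localization.AtPrime p)
        (LocalizedModule p.primeCompl (E ⧸ Submodule.span S {e})) = d := by
  have hfin : IsFiniteLength (Localization.AtPrime p) (LocalizedModule p.primeCompl E) := by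
    rw [← Module.length_ne_top_iff, hd]
    exact_mod_cast ENat.natCast_ne_top (d + 1)
  obtain ⟨hN, hA⟩ := isFiniteLength_iff_isNoetherian_isArtinian.mp hfin
  have : Nontrivial (LocalizedModule p.primeCompl E) := by
    rw [← Module.length_pos_iff (R := Localization.AtPrime p), hd]
    exact_mod_cast Nat.succ_pos d
  obtain ⟨T, hT⟩ := IsAtomic.exists_atom
    (Submodule (Localization.AtPrime p) (LocalizedModule p.primeCompl E))
  have hTs : IsSimpleModule (Localization.AtPrime p) T := isSimpleModule_iff_isAtom.mpr hT
  obtain ⟨x, hxT, hx0⟩ := T.exists_mem_ne_zero_of_ne_bot hT.1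
  have hann : ∀ a ∈ IsLocalRing.maximalIdeal (Localization.AtPrime p), ∀ y ∈ T, a • y = 0 := by
    have hm := IsSimpleModule.annihilator_isMaximal (R := Localization.AtPrime p) (M := T)
    rw [← IsLocalRing.eq_maximalIdeal hm]
    intro a ha y hy
    exact congrArg Subtype.val (Module.mem_annihilator.mp ha ⟨y, hy⟩)
  let mk := LocalizedModule.mkLinearMap p.primeCompl E
  have hinj : ∀ u : S, u ∉ p → ∀ y : LocalizedModule p.primeCompl E, u • y = 0 → y = 0 := by
    intro u hu y h
    apply IsLocalizedModule.smul_injective mk (⟨u, hu⟩ : p.primeCompl)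
    simpa [Submonoid.smul_def] using h
  obtain ⟨⟨e₀, s₀⟩, he₀⟩ := IsLocalizedModule.surj p.primeCompl mk x
  have hsmulT : ∀ s : S, ∀ y ∈ T, s • y ∈ T := fun s y hy => by
    rw [← algebraMap_smul (Localization.AtPrime p)]
    exact T.smul_mem _ hy
  have he₀T : mk e₀ ∈ T := by
    rw [← he₀]
    exact hsmulT _ _ hxT
  have he₀0 : mk e₀ ≠ 0 := by
    rw [← he₀]
    exact fun h => hx0 (hinj _ s₀.2 _ h)
  -- A multiple `u • e₀` with `u ∉ p` is killed by `p` already in `E`.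
  obtain ⟨u, hu, hu'⟩ : ∃ u ∉ p,
      ∀ y ∈ Submodule.map (LinearMap.toSpanSingleton S E e₀) p, u • y = 0 := by
    refine exists_notMem_forall_smul_eq_zero p ((IsNoetherian.noetherian p).map _) ?_
    rintro _ ⟨s, hs, rfl⟩
    have h0 : mk (s • e₀) = 0 := by
      rw [map_smul, ← algebraMap_smul (Localization.AtPrime p)]
      refine hann _ ?_ _ he₀T
      exact (IsLocalization.AtPrime.to_map_mem_maximal_iff (Localization.AtPrime p) p s).mpr hs
    obtain ⟨v, hv⟩ := (IsLocalizedModule.eq_zero_iff p.primeCompl mk).mp h0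
    exact ⟨v, v.2, hv⟩
  have heT : mk (u • e₀) ∈ T := by
    rw [map_smul]
    exact hsmulT _ _ he₀T
  have he0 : mk (u • e₀) ≠ 0 := by
    rw [map_smul]
    exact fun h => he₀0 (hinj _ hu _ h)
  refine ⟨u • e₀, fun s => ⟨fun h => ?_, fun h => ?_⟩, ?_⟩
  · by_contra hs
    refine he0 (hinj s hs _ ?_)
    rw [← map_smul, h, map_zero]
  · rw [smul_comm]
    exact hu' _ ⟨s, h, rfl⟩
  · have hspan : Submodule.localized p.primeCompl (Submodule.span S {u • e₀}) = T := by
      rw [Submodule.localized, Submodule.localized'_span, Set.image_singleton]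
      refine (hT.le_iff.mp ?_).resolve_left ?_
      · rwa [Submodule.span_singleton_le_iff_mem]
      · rwa [Submodule.span_singleton_eq_bot]
    rw [← (localizedQuotientEquiv p.primeCompl (Submodule.span S {u • e₀})).length_eq, hspan]
    have hadd := Module.length_eq_add_of_exact T.subtype T.mkQ T.subtype_injective
      T.mkQ_surjective (LinearMap.exact_subtype_mkQ T)
    rw [hd, Module.length_eq_one, add_comm 1] at hadd
    exact (WithTop.add_right_cancel (ENat.natCast_ne_top 1) hadd).symm

/-- `P` is a submodule of `Q` that has a filtration with `d` successive quotients isomorphic to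
`S ⧸ p`. Each step adjoins one element `q` whose annihilator modulo the previous submodule
is `p`. -/
inductive HasPrimeFiltration {Q : Type*} [AddCommGroup Q] [Module S Q] : ℕ → Submodule S Q → Prop
  | bot : HasPrimeFiltration 0 ⊥
  | step {d : ℕ} {P : Submodule S Q} (q : Q) (h : HasPrimeFiltration d P)
      (hq : ∀ s : S, s • q ∈ P ↔ s ∈ p) : HasPrimeFiltration (d + 1) (P ⊔ Submodule.span S {q})

theorem exists_hasPrimeFiltration_add [IsNoetherianRing S] {Q : Type*} [AddCommGroup Q]
    [Module S Q] {i : ℕ} (d : ℕ) {P : Submodule S Q} (hP : HasPrimeFiltration p i P)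
    (hd : Module.length (Localization.AtPrime p) (LocalizedModule p.primeCompl (Q ⧸ P)) = d) :
    ∃ P' : Submodule S Q, HasPrimeFiltration p (i + d) P' ∧
      Subsingleton (LocalizedModule p.primeCompl (Q ⧸ P')) := by
  induction d generalizing i P with
  | zero => exact ⟨P, hP, Module.length_eq_zero_iff.mp hd⟩
  | succ d ih =>
    obtain ⟨e, he, hlen⟩ := exists_annihilator_eq_prime p (by simpa using hd)
    obtain ⟨q, rfl⟩ := P.mkQ_surjective e
    have hstep := hP.step q fun s => by
      rw [← he, ← map_smul, Submodule.mkQ_apply, Submodule.Quotient.mk_eq_zero]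
    have hmap : Submodule.span S {P.mkQ q} = (P ⊔ Submodule.span S {q}).map P.mkQ := by
      rw [Submodule.map_sup, Submodule.map_span, Set.image_singleton, Submodule.mkQ_map_self,
        bot_sup_eq]
    rw [hmap] at hlen
    have e' := Submodule.quotientQuotientEquivQuotient P (P ⊔ Submodule.span S {q}) le_sup_left
    obtain ⟨P', hP', hs⟩ := ih hstep (by
      rw [← hlen]
      exact ((IsLocalizedModule.mapEquiv p.primeCompl
        (LocalizedModule.mkLinearMap p.primeCompl _)
        (LocalizedModule.mkLinearMap p.primeCompl _)
        (Localization.AtPrime p) e').length_eq).symm)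
    exact ⟨P', by rwa [add_right_comm, add_assoc] at hP', hs⟩

/-- A finite module whose localization at `p` has length `d` contains, up to an element outside
`p`, a submodule filtered by `d` copies of `S ⧸ p`. -/
theorem exists_hasPrimeFiltration [IsNoetherianRing S] {Q : Type*} [AddCommGroup Q]
    [Module S Q] [Module.Finite S Q] {d : ℕ}
    (hd : Module.length (Localization.AtPrime p) (LocalizedModule p.primeCompl Q) = d) :
    ∃ P : Submodule S Q, HasPrimeFiltration p d P ∧ ∃ f ∉ p, ∀ x : Q, f • x ∈ P := by
  have e := (Submodule.quotEquivOfEqBot (⊥ : Submodule S Q) rfl)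
  obtain ⟨P, hP, hs⟩ := exists_hasPrimeFiltration_add p (Q := Q) d .bot (by
      rw [← hd]
      exact (IsLocalizedModule.mapEquiv p.primeCompl
        (LocalizedModule.mkLinearMap p.primeCompl _)
        (LocalizedModule.mkLinearMap p.primeCompl _)
        (Localization.AtPrime p) e).length_eq)
  obtain ⟨f, hf, hf'⟩ := exists_notMem_forall_smul_eq_zero p
    (Module.Finite.fg_top : (⊤ : Submodule S (Q ⧸ P)).FG) fun x _ => by
      obtain ⟨r, hr, hrx⟩ := LocalizedModule.subsingleton_iff.mp hs x
      exact ⟨r, hr, hrx⟩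
  refine ⟨P, by rwa [zero_add] at hP, f, hf, fun x => ?_⟩
  rw [← Submodule.Quotient.mk_eq_zero, Submodule.Quotient.mk_smul]
  exact hf' _ trivial

end Localization

/-! ### Lengths of quotients by multiples of ideals -/

section Length

variable (R : Type*) {S : Type*} [CommRing R] [CommRing S] [Algebra R S]
variable {A B : Type*} [AddCommGroup A] [Module S A] [Module R A] [IsScalarTower R S A]
variable [AddCommGroup B] [Module S B] [Module R B] [IsScalarTower R S B]

theorem length_eq_of_bijective (f : A →ₗ[S] B) (hf : Function.Bijective f) :
    Module.length R A = Module.length R B :=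
  ((LinearEquiv.ofBijective f hf).restrictScalars R).length_eq

theorem length_eq_add_of_exact_restrictScalars {C : Type*} [AddCommGroup C] [Module S C]
    [Module R C] [IsScalarTower R S C] (f : A →ₗ[S] B) (g : B →ₗ[S] C)
    (hf : Function.Injective f) (hg : Function.Surjective g) (h : Function.Exact f g) :
    Module.length R B = Module.length R A + Module.length R C :=
  Module.length_eq_add_of_exact (f.restrictScalars R) (g.restrictScalars R) hf hg h

/-- Length is additive along an extension `0 → A → B → S ⧸ p → 0` even after tensoring with
`S ⧸ J`, provided `p ⊓ J = p * J`, that is, `Tor₁ (S ⧸ p) (S ⧸ J) = 0`. -/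
theorem length_quotient_smul_top_of_extension {p J : Ideal S} (hJ : p ⊓ J ≤ p * J)
    (i : A →ₗ[S] B) (hi : Function.Injective i) (q : B)
    (htop : ∀ b : B, ∃ (a : A) (s : S), b = i a + s • q)
    (hq : ∀ s : S, s • q ∈ LinearMap.range i ↔ s ∈ p) :
    Module.length R (B ⧸ (J • ⊤ : Submodule S B)) =
      Module.length R (A ⧸ (J • ⊤ : Submodule S A)) + Module.length R (S ⧸ p ⊔ J) := by
  have hJB : ∀ b ∈ (J • ⊤ : Submodule S B), ∃ a ∈ (J • ⊤ : Submodule S A), ∃ j ∈ J,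
      b = i a + j • q := by
    intro b hb
    refine Submodule.smul_induction_on hb (fun j hj n _ => ?_) ?_
    · obtain ⟨a, s, rfl⟩ := htop n
      refine ⟨j • a, Submodule.smul_mem_smul hj trivial, j * s, J.mul_mem_right s hj, ?_⟩
      rw [smul_add, map_smul, mul_smul]
    · rintro _ _ ⟨a, ha, j, hj, rfl⟩ ⟨a', ha', j', hj', rfl⟩
      refine ⟨a + a', add_mem ha ha', j + j', add_mem hj hj', ?_⟩
      rw [map_add, add_smul]
      abel
  have hpq : ∀ s ∈ p * J, ∃ a ∈ (J • ⊤ : Submodule S A), s • q = i a := by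
    intro s hs
    refine Submodule.mul_induction_on hs (fun x hx j hj => ?_) ?_
    · obtain ⟨a, ha⟩ := (hq x).mpr hx
      refine ⟨j • a, Submodule.smul_mem_smul hj trivial, ?_⟩
      rw [map_smul, ha, smul_smul, mul_comm]
    · rintro x y ⟨a, ha, hxa⟩ ⟨a', ha', hya⟩
      exact ⟨a + a', add_mem ha ha', by rw [add_smul, hxa, hya, map_add]⟩
  have hle : (J • ⊤ : Submodule S A) ≤ (J • ⊤ : Submodule S B).comap i := by
    rw [← Submodule.map_le_iff_le_comap, Submodule.map_smul'']
    exact smul_mono_right _ le_top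
  let f : (A ⧸ (J • ⊤ : Submodule S A)) →ₗ[S] B ⧸ (J • ⊤ : Submodule S B) :=
    Submodule.mapQ _ _ i hle
  have hf : Function.Injective f := by
    rw [← LinearMap.ker_eq_bot, eq_bot_iff]
    intro x hx
    obtain ⟨x, rfl⟩ := Submodule.mkQ_surjective _ x
    have hx' : i x ∈ (J • ⊤ : Submodule S B) := by
      simpa [f] using hx
    obtain ⟨a, ha, j, hj, h⟩ := hJB _ hx'
    have hjq : j • q = i (x - a) := by rw [map_sub, h]; abel
    obtain ⟨a', ha', h'⟩ := hpq j (hJ ⟨(hq j).mp ⟨_, hjq.symm⟩, hj⟩)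
    have hxa : x = a + a' := hi (by rw [h, map_add, h'])
    rw [Submodule.mem_bot, Submodule.mkQ_apply, Submodule.Quotient.mk_eq_zero, hxa]
    exact add_mem ha ha'
  let g : S →ₗ[S] (B ⧸ (J • ⊤ : Submodule S B)) ⧸ LinearMap.range f :=
    LinearMap.toSpanSingleton S _ (Submodule.mkQ _ (Submodule.mkQ _ q))
  have hg : Function.Surjective g := by
    intro y
    obtain ⟨y, rfl⟩ := Submodule.mkQ_surjective _ y
    obtain ⟨b, rfl⟩ := Submodule.mkQ_surjective _ y
    obtain ⟨a, s, rfl⟩ := htop b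
    refine ⟨s, ?_⟩
    rw [LinearMap.toSpanSingleton_apply, ← map_smul, ← map_smul, ← sub_eq_zero, ← map_sub,
      ← map_sub, Submodule.mkQ_apply, Submodule.Quotient.mk_eq_zero]
    exact ⟨Submodule.mkQ _ (-a), by simp [f]⟩
  have hker : LinearMap.ker g = p ⊔ J := by
    ext s
    rw [LinearMap.mem_ker, LinearMap.toSpanSingleton_apply, ← map_smul, ← map_smul,
      Submodule.mkQ_apply, Submodule.Quotient.mk_eq_zero]
    constructor
    · rintro ⟨a, ha⟩
      obtain ⟨a, rfl⟩ := Submodule.mkQ_surjective _ a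
      have hmem : s • q - i a ∈ (J • ⊤ : Submodule S B) := by
        rw [← Submodule.Quotient.mk_eq_zero, Submodule.Quotient.mk_sub, sub_eq_zero]
        exact ha.symm
      obtain ⟨a', _, j, hj, h⟩ := hJB _ hmem
      have hsj : (s - j) • q = i (a + a') := by
        rw [sub_smul, map_add, ← sub_eq_iff_eq_add', sub_right_comm, h, add_sub_cancel_right]
      rw [← sub_add_cancel s j]
      exact Submodule.add_mem_sup ((hq _).mp ⟨_, hsj.symm⟩) hj
    · intro hs
      obtain ⟨x, hx, j, hj, rfl⟩ := Submodule.mem_sup.mp hs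
      obtain ⟨a, ha⟩ := (hq x).mpr hx
      refine ⟨Submodule.mkQ _ a, ?_⟩
      change Submodule.mkQ _ (i a) = Submodule.mkQ _ ((x + j) • q)
      rw [ha, add_smul, map_add, left_eq_add, Submodule.mkQ_apply, Submodule.Quotient.mk_eq_zero]
      exact Submodule.smul_mem_smul hj trivial
  rw [length_eq_add_of_exact_restrictScalars R f (LinearMap.range f).mkQ hf
    (Submodule.mkQ_surjective _) (LinearMap.exact_map_mkQ_range f)]
  congr 1
  exact (length_eq_of_bijective R
    ((Submodule.quotEquivOfEq _ _ hker).symm.trans (g.quotKerEquivOfSurjective hg)).toLinearMap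
    (LinearEquiv.bijective _)).symm

variable {Q : Type*} [AddCommGroup Q] [Module S Q] [Module R Q] [IsScalarTower R S Q]

theorem HasPrimeFiltration.length_quotient_smul_top {p : Ideal S} {d : ℕ} {P : Submodule S Q}
    (h : HasPrimeFiltration p d P) {J : Ideal S} (hJ : p ⊓ J ≤ p * J) :
    Module.length R (P ⧸ (J • ⊤ : Submodule S P)) = d * Module.length R (S ⧸ p ⊔ J) := by
  induction h with
  | bot => simp
  | @step d P q _ hq ih =>
    have hqm : q ∈ P ⊔ Submodule.span S {q} :=
      Submodule.mem_sup_right (Submodule.mem_span_singleton_self q)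
    rw [length_quotient_smul_top_of_extension R hJ
      (Submodule.inclusion (le_sup_left : P ≤ P ⊔ Submodule.span S {q}))
      (Submodule.inclusion_injective _) ⟨q, hqm⟩, ih, Nat.cast_add, Nat.cast_one, add_mul, one_mul]
    · rintro ⟨b, hb⟩
      obtain ⟨a, ha, y, hy, rfl⟩ := Submodule.mem_sup.mp hb
      obtain ⟨s, rfl⟩ := Submodule.mem_span_singleton.mp hy
      exact ⟨⟨a, ha⟩, s, rfl⟩
    · intro s
      rw [← hq s, Submodule.range_inclusion]
      rfl

theorem length_le_add_of_ker_le_range {C : Type*} [AddCommGroup C] [Module S C] [Module R C]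
    [IsScalarTower R S C] (f : A →ₗ[S] B) (g : B →ₗ[S] C) (hg : Function.Surjective g)
    (h : LinearMap.ker g ≤ LinearMap.range f) :
    Module.length R B ≤ Module.length R A + Module.length R C := by
  rw [length_eq_add_of_exact_restrictScalars R (LinearMap.ker g).subtype g
    (Submodule.subtype_injective _) hg (LinearMap.exact_subtype_ker_map g)]
  gcongr
  exact (Module.length_le_of_injective ((Submodule.inclusion h).restrictScalars R)
    (Submodule.inclusion_injective h)).trans
    (Module.length_le_of_surjective (f.rangeRestrict.restrictScalars R)
      f.surjective_rangeRestrict)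

/-- If each power `I ^ j` is generated by a finite set `T j`, then the length of `Q ⧸ I ^ n Q` is
bounded as for a free module over the associated graded ring: `I ^ j Q ⧸ I ^ (j + 1) Q` is a
quotient of a sum of copies of `Q ⧸ I Q`, one for each element of `T j`. -/
theorem length_quotient_pow_smul_top_le {I : Ideal S} (T : ℕ → Finset S)
    (hT : ∀ j, I ^ j = Ideal.span (T j)) (n : ℕ) :
    Module.length R (Q ⧸ (I ^ n • ⊤ : Submodule S Q)) ≤
      (∑ j ∈ Finset.range n, (T j).card : ℕ) *
        Module.length R (Q ⧸ (I • ⊤ : Submodule S Q)) := by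
  classical
  induction n with
  | zero =>
    have : Subsingleton (Q ⧸ (I ^ 0 • ⊤ : Submodule S Q)) := by
      rw [Submodule.Quotient.subsingleton_iff]
      simp
    simp
  | succ n ih =>
    have hmul : ∀ b ∈ I ^ n, (I • ⊤ : Submodule S Q) ≤
        (I ^ (n + 1) • ⊤ : Submodule S Q).comap (b • LinearMap.id) := by
      intro b hb x hx
      rw [Submodule.mem_comap, LinearMap.smul_apply, LinearMap.id_apply, pow_succ, mul_smul]
      exact Submodule.smul_mem_smul hb hx
    have hTI : ∀ b : T n, (b : S) ∈ I ^ n := fun b => by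
      rw [hT]
      exact Ideal.subset_span b.2
    let f : (T n → Q ⧸ (I • ⊤ : Submodule S Q)) →ₗ[S] Q ⧸ (I ^ (n + 1) • ⊤ : Submodule S Q) :=
      ∑ b : T n, (Submodule.mapQ _ _ _ (hmul b (hTI b))) ∘ₗ LinearMap.proj b
    let g : (Q ⧸ (I ^ (n + 1) • ⊤ : Submodule S Q)) →ₗ[S] Q ⧸ (I ^ n • ⊤ : Submodule S Q) :=
      Submodule.factor (Submodule.smul_mono_left (Ideal.pow_le_pow_right n.le_succ))
    have hfg : LinearMap.ker g ≤ LinearMap.range f := by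
      intro y hy
      obtain ⟨x, rfl⟩ := Submodule.mkQ_surjective _ y
      have hx : x ∈ (I ^ n • ⊤ : Submodule S Q) := by
        simpa [g] using hy
      refine Submodule.smul_induction_on
        (p := fun x => Submodule.mkQ (I ^ (n + 1) • ⊤ : Submodule S Q) x ∈ LinearMap.range f)
        hx (fun s hs x _ => ?_) (fun x y hx hy => ?_)
      · rw [hT] at hs
        refine Submodule.span_induction
          (p := fun s _ => Submodule.mkQ (I ^ (n + 1) • ⊤ : Submodule S Q) (s • x) ∈
            LinearMap.range f) ?_ ?_ ?_ ?_ hs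
        · intro b hb
          refine ⟨Pi.single ⟨b, hb⟩ (Submodule.mkQ _ x), ?_⟩
          rw [LinearMap.sum_apply, Finset.sum_eq_single ⟨b, hb⟩]
          · simp
          · intro b' _ hb'
            simp [Pi.single_eq_of_ne hb']
          · simp
        · simp
        · intro s s' _ _ h h'
          rw [add_smul, map_add]
          exact add_mem h h'
        · intro a s _ h
          rw [smul_assoc, map_smul]
          exact Submodule.smul_mem _ _ h
      · rw [map_add]
        exact add_mem hx hy
    refine (length_le_add_of_ker_le_range R f g
      (Submodule.factor_surjective _) hfg).trans ?_
    rw [Module.length_pi, Finset.sum_range_succ, Nat.cast_add, add_mul, add_comm]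
    gcongr
    simp

/-- If `f` carries `Q` into `P` and is invertible modulo `I`, then `P ⧸ I P = Q ⧸ I Q`. -/
theorem length_quotient_smul_top_eq_of_smul_mem {I : Ideal S} {P : Submodule S Q} {f c : S}
    (hf : ∀ x : Q, f • x ∈ P) (hc : c * f - 1 ∈ I) :
    Module.length R (Q ⧸ (I • ⊤ : Submodule S Q)) =
      Module.length R (P ⧸ (I • ⊤ : Submodule S P)) := by
  have hle : (I • ⊤ : Submodule S P) ≤ (I • ⊤ : Submodule S Q).comap P.subtype := by
    rw [← Submodule.map_le_iff_le_comap, Submodule.map_smul'']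
    exact smul_mono_right _ le_top
  have hfI : ∀ x ∈ (I • ⊤ : Submodule S Q),
      (⟨f • x, hf x⟩ : P) ∈ (I • ⊤ : Submodule S P) := by
    intro x hx
    refine Submodule.smul_induction_on
      (p := fun x => (⟨f • x, hf x⟩ : P) ∈ (I • ⊤ : Submodule S P)) hx
      (fun a ha y _ => ?_) (fun x y hx hy => ?_)
    · have : (⟨f • a • y, hf _⟩ : P) = a • ⟨f • y, hf y⟩ := Subtype.ext (smul_comm _ _ _)
      rw [this]
      exact Submodule.smul_mem_smul ha trivial
    · have : (⟨f • (x + y), hf _⟩ : P) = ⟨f • x, hf x⟩ + ⟨f • y, hf y⟩ :=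
        Subtype.ext (smul_add _ _ _)
      rw [this]
      exact add_mem hx hy
  let g : (P ⧸ (I • ⊤ : Submodule S P)) →ₗ[S] Q ⧸ (I • ⊤ : Submodule S Q) :=
    Submodule.mapQ _ _ P.subtype hle
  have hg : Function.Bijective g := by
    constructor
    · rw [← LinearMap.ker_eq_bot, eq_bot_iff]
      intro y hy
      obtain ⟨x, rfl⟩ := Submodule.mkQ_surjective _ y
      have hx : (x : Q) ∈ (I • ⊤ : Submodule S Q) := by
        simpa [g] using hy
      rw [Submodule.mem_bot, Submodule.mkQ_apply, Submodule.Quotient.mk_eq_zero]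
      have hx' : x = c • ⟨f • (x : Q), hf x⟩ - (c * f - 1) • x := by
        apply Subtype.ext
        simp [sub_smul, mul_smul]
      rw [hx']
      exact sub_mem (Submodule.smul_mem _ _ (hfI _ hx)) (Submodule.smul_mem_smul hc trivial)
    · intro y
      obtain ⟨x, rfl⟩ := Submodule.mkQ_surjective _ y
      refine ⟨Submodule.mkQ _ ⟨(c * f) • x, by rw [mul_smul]; exact P.smul_mem _ (hf x)⟩, ?_⟩
      change Submodule.mkQ _ ((c * f) • x) = Submodule.mkQ _ x
      rw [← sub_eq_zero, ← map_sub, Submodule.mkQ_apply, Submodule.Quotient.mk_eq_zero]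
      have : (c * f) • x - x = (c * f - 1) • x := by rw [sub_smul, one_smul]
      rw [this]
      exact Submodule.smul_mem_smul hc trivial
  exact (length_eq_of_bijective R g hg).symm

/-- The Artin–Rees lemma bounds the `I`-adic growth of a submodule by that of the module, up to a
shift. -/
theorem exists_length_quotient_pow_smul_top_le [IsNoetherianRing S] [Module.Finite S Q]
    (I : Ideal S) (P : Submodule S Q) :
    ∃ c : ℕ, ∀ n, Module.length R (P ⧸ (I ^ n • ⊤ : Submodule S P)) ≤
      Module.length R (Q ⧸ (I ^ (n + c) • ⊤ : Submodule S Q)) := by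
  obtain ⟨c, hc⟩ := Ideal.exists_pow_inf_eq_pow_smul I P
  refine ⟨c, fun n => ?_⟩
  let g : P →ₗ[S] Q ⧸ (I ^ (n + c) • ⊤ : Submodule S Q) := Submodule.mkQ _ ∘ₗ P.subtype
  have hker : LinearMap.ker g ≤ (I ^ n • ⊤ : Submodule S P) := by
    intro x hx
    have hx' : (x : Q) ∈ I ^ (n + c) • ⊤ ⊓ P := ⟨by simpa [g] using hx, x.2⟩
    rw [hc (n + c) (Nat.le_add_left c n), Nat.add_sub_cancel] at hx'
    have hmem : (x : Q) ∈ (I ^ n • ⊤ : Submodule S P).map P.subtype := by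
      rw [Submodule.map_smul'', Submodule.map_top, Submodule.range_subtype]
      exact Submodule.smul_mono le_rfl inf_le_right hx'
    obtain ⟨y, hy, hyx⟩ := hmem
    rwa [← Subtype.ext hyx]
  refine (Module.length_le_of_surjective ((Submodule.factor hker).restrictScalars R)
    (Submodule.factor_surjective hker)).trans ?_
  refine (g.quotKerEquivRange.restrictScalars R).length_eq.trans_le ?_
  exact Module.length_le_of_injective ((LinearMap.range g).subtype.restrictScalars R)
    (Submodule.subtype_injective _)

end Length

/-! ### The ideal of a point in affine space -/

section Polynomial

open MvPolynomial

/-- The exponents of the monomials of degree less than `n` in `t` variables. -/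
def lowExponents (t n : ℕ) : Finset (Fin t →₀ ℕ) :=
  (Finset.range n).biUnion fun j => Finset.finsuppAntidiag Finset.univ j

theorem mem_finsuppAntidiag_univ {t j : ℕ} {x : Fin t →₀ ℕ} :
    x ∈ Finset.finsuppAntidiag Finset.univ j ↔ x.degree = j := by
  simp [Finset.mem_finsuppAntidiag, Finsupp.degree_eq_sum]

@[simp]
theorem mem_lowExponents {t n : ℕ} {x : Fin t →₀ ℕ} : x ∈ lowExponents t n ↔ x.degree < n := by
  simp only [lowExponents, Finset.mem_biUnion, Finset.mem_range, mem_finsuppAntidiag_univ,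
    exists_eq_right']

theorem card_lowExponents (t n : ℕ) : (lowExponents t n).card =
    ∑ j ∈ Finset.range n, (Finset.finsuppAntidiag (Finset.univ : Finset (Fin t)) j).card := by
  refine Finset.card_biUnion fun i _ j _ hij => ?_
  rw [Function.onFun, Finset.disjoint_left]
  intro x hi hj
  rw [mem_finsuppAntidiag_univ] at hi hj
  exact hij (hi.symm.trans hj)

theorem card_lowExponents_one (t : ℕ) : (lowExponents t 1).card = 1 := by
  rw [Finset.card_eq_one]
  refine ⟨0, ?_⟩
  ext x
  simp [Finsupp.degree_eq_zero_iff]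

theorem card_lowExponents_le (t n : ℕ) : (lowExponents t n).card ≤ n ^ t := by
  have h := Finset.card_le_card_of_injOn (s := lowExponents t n)
    (t := Fintype.piFinset fun _ : Fin t => Finset.range n) (fun x => ⇑x) ?_
    (DFunLike.coe_injective.injOn)
  · simpa using h
  · intro x hx
    rw [Finset.mem_coe, mem_lowExponents] at hx
    simp only [Finset.mem_coe, Fintype.mem_piFinset, Finset.mem_range]
    exact fun i => (Finsupp.le_degree i x).trans_lt hx

variable {R : Type*} [CommRing R] {t : ℕ}

/-- The translation `z ↦ z + α` of the polynomial ring, which carries the ideal of the point `α`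
to that of the origin. -/
noncomputable def translate (α : Fin t → R) :
    MvPolynomial (Fin t) R ≃ₐ[R] MvPolynomial (Fin t) R :=
  AlgEquiv.ofAlgHom (aeval fun i => X i + C (α i)) (aeval fun i => X i - C (α i))
    (by ext i; simp [algHom_C, algebraMap_eq]) (by ext i; simp [algHom_C, algebraMap_eq])

theorem mem_ker_eval_iff (α : Fin t → R) (p : MvPolynomial (Fin t) R) :
    p ∈ RingHom.ker (eval α) ↔ translate α p ∈ idealOfVars (Fin t) R := by
  have h : (aeval (R := R) (0 : Fin t → R)).comp (translate α).toAlgHom = aeval α := by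
    ext i
    simp [translate]
  have h' : eval α p = constantCoeff (translate α p) := by
    rw [← aeval_eq_eval, ← h, constantCoeff_eq, ← constantCoeff_eq]
    simp [aeval_eq_eval, constantCoeff_eq]
  rw [RingHom.mem_ker, h', ← pow_one (idealOfVars (Fin t) R), mem_pow_idealOfVars_iff',
    constantCoeff_eq]
  simp [Finsupp.degree_eq_zero_iff]

theorem mem_map_translate_symm (α : Fin t → R) {I : Ideal (MvPolynomial (Fin t) R)}
    {p : MvPolynomial (Fin t) R} :
    p ∈ I.map (translate α).symm ↔ translate α p ∈ I := by
  rw [Ideal.mem_map_of_equiv]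
  constructor
  · rintro ⟨q, hq, rfl⟩
    rwa [AlgEquiv.apply_symm_apply]
  · exact fun h => ⟨_, h, AlgEquiv.symm_apply_apply _ _⟩

theorem ker_eval_pow (α : Fin t → R) (n : ℕ) : RingHom.ker (eval α) ^ n =
    (idealOfVars (Fin t) R ^ n).map (translate α).symm := by
  have h : RingHom.ker (eval α) = (idealOfVars (Fin t) R).map (translate α).symm := by
    ext p
    rw [mem_ker_eval_iff, mem_map_translate_symm]
  rw [h, Ideal.map_pow]

theorem mem_ker_eval_pow_iff (α : Fin t → R) (n : ℕ) (p : MvPolynomial (Fin t) R) :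
    p ∈ RingHom.ker (eval α) ^ n ↔ ∀ x, x.degree < n → coeff x (translate α p) = 0 := by
  rw [ker_eval_pow, mem_map_translate_symm, mem_pow_idealOfVars_iff']

theorem ker_eval_pow_eq_span [DecidableEq (MvPolynomial (Fin t) R)] (α : Fin t → R) (n : ℕ) :
    RingHom.ker (eval α) ^ n = Ideal.span (((Finset.finsuppAntidiag Finset.univ n).image
      fun x => (translate α).symm (monomial x 1) : Finset (MvPolynomial (Fin t) R)) :
        Set (MvPolynomial (Fin t) R)) := by
  rw [ker_eval_pow, pow_idealOfVars_eq_span, Ideal.map_span, Finset.coe_image, Set.image_image]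
  congr 2
  ext x
  simp [Finset.mem_finsuppAntidiag, Finsupp.degree_eq_sum]

/-- The Taylor expansion of `p` at the point `α`. -/
theorem eq_sum_translate_symm_monomial (α : Fin t → R) (p : MvPolynomial (Fin t) R) :
    p = ∑ x ∈ (translate α p).support,
      C (coeff x (translate α p)) * (translate α).symm (monomial x 1) := by
  conv_lhs => rw [← (translate α).symm_apply_apply p, (translate α p).as_sum, map_sum]
  refine Finset.sum_congr rfl fun x _ => ?_
  rw [← mul_one (coeff x _), ← smul_eq_mul, ← smul_monomial, map_smul, smul_eq_C_mul, smul_eq_mul,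
    mul_one]

theorem translate_symm_monomial_mem (α : Fin t → R) {n : ℕ} {x : Fin t →₀ ℕ} (hx : n ≤ x.degree) :
    (translate α).symm (monomial x 1) ∈ RingHom.ker (eval α) ^ n := by
  classical
  rw [mem_ker_eval_pow_iff]
  intro y hy
  rw [AlgEquiv.apply_symm_apply, coeff_monomial, if_neg]
  rintro rfl
  exact absurd hx hy.not_ge

variable [IsLocalRing R]

theorem C_mem_extMax {r : R} (hr : r ∈ IsLocalRing.maximalIdeal R) : C r ∈ extMax R t :=
  Ideal.mem_map_of_mem C hr

theorem coeff_translate_mem_maximalIdeal (α : Fin t → R) {p : MvPolynomial (Fin t) R}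
    (hp : p ∈ extMax R t) (x : Fin t →₀ ℕ) :
    coeff x (translate α p) ∈ IsLocalRing.maximalIdeal R := by
  have hle : extMax R t ≤ (extMax R t).comap (translate α) := by
    rw [extMax, Ideal.map_le_iff_le_comap]
    intro r hr
    rw [Ideal.mem_comap, Ideal.mem_comap, ← algebraMap_eq, AlgEquiv.commutes]
    exact Ideal.mem_map_of_mem _ hr
  exact mem_map_C_iff.mp (hle hp) x

/-- The powers of the ideal of a point are spanned over `R` by part of a basis of `S`, hence
`Tor₁ (S ⧸ 𝔪S) (S ⧸ I ^ n) = 0`. -/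
theorem extMax_inf_ker_eval_pow_le (α : Fin t → R) (n : ℕ) :
    extMax R t ⊓ RingHom.ker (eval α) ^ n ≤ extMax R t * RingHom.ker (eval α) ^ n := by
  rintro p ⟨hp, hpn⟩
  rw [eq_sum_translate_symm_monomial α p]
  refine sum_mem fun x hx => Ideal.mul_mem_mul
    (C_mem_extMax (coeff_translate_mem_maximalIdeal α hp x)) (translate_symm_monomial_mem α ?_)
  by_contra! h
  exact mem_support_iff.mp hx ((mem_ker_eval_pow_iff α n p).mp hpn x h)

/-- As for a polynomial ring over the residue field, `S ⧸ (𝔪S + I ^ n)` has a basis of monomials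
of degree less than `n`. -/
theorem length_quotient_extMax_sup_ker_eval_pow (α : Fin t → R) (n : ℕ) :
    Module.length R (MvPolynomial (Fin t) R ⧸ extMax R t ⊔ RingHom.ker (eval α) ^ n) =
      (lowExponents t n).card := by
  let f : MvPolynomial (Fin t) R →ₗ[R] lowExponents t n → IsLocalRing.ResidueField R :=
    LinearMap.pi fun x => (Algebra.linearMap R (IsLocalRing.ResidueField R)) ∘ₗ
      (lcoeff R (x : Fin t →₀ ℕ)) ∘ₗ (translate α).toLinearMap
  have hf (p) (x) : f p x = IsLocalRing.residue R (coeff x (translate α p)) := rfl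
  have hsurj : Function.Surjective f := by
    classical
    intro v
    choose r hr using fun x => IsLocalRing.residue_surjective (v x)
    refine ⟨(translate α).symm (∑ x : lowExponents t n, monomial x (r x)), ?_⟩
    ext x
    rw [hf, AlgEquiv.apply_symm_apply, coeff_sum, Finset.sum_eq_single x, coeff_monomial,
      if_pos rfl, hr]
    · intro y _ hy
      rw [coeff_monomial, if_neg fun h => hy (Subtype.ext h)]
    · simp
  have hker : LinearMap.ker f =
      Submodule.restrictScalars R (extMax R t ⊔ RingHom.ker (eval α) ^ n) := by
    ext p
    rw [LinearMap.mem_ker, Submodule.restrictScalars_mem]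
    constructor
    · intro h
      rw [eq_sum_translate_symm_monomial α p]
      refine sum_mem fun x _ => ?_
      by_cases hx : x.degree < n
      · refine Ideal.mem_sup_left (Ideal.mul_mem_right _ _ (C_mem_extMax ?_))
        rw [← IsLocalRing.residue_eq_zero_iff]
        exact congrFun h ⟨x, mem_lowExponents.mpr hx⟩
      · exact Ideal.mem_sup_right
          (Ideal.mul_mem_left _ _ (translate_symm_monomial_mem α (not_lt.mp hx)))
    · intro h
      obtain ⟨a, ha, b, hb, rfl⟩ := Submodule.mem_sup.mp h
      ext x
      rw [hf, map_add, coeff_add,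
        (mem_ker_eval_pow_iff α n b).mp hb x (mem_lowExponents.mp x.2), add_zero]
      exact (IsLocalRing.residue_eq_zero_iff _).mpr (coeff_translate_mem_maximalIdeal α ha x)
  have hres : Module.length R (IsLocalRing.ResidueField R) = 1 := by
    rw [Module.length_eq_of_surjective (R := IsLocalRing.ResidueField R)
      (IsLocalRing.residue_surjective (R := R)), Module.length_eq_one]
  rw [← (Submodule.Quotient.restrictScalarsEquiv R
    (extMax R t ⊔ RingHom.ker (eval α) ^ n)).length_eq, ← hker,
    (f.quotKerEquivOfSurjective hsurj).length_eq, Module.length_pi, hres, mul_one,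
    ENat.card_eq_coe_fintype_card, Fintype.card_coe]

end Polynomial
/-! ### General vectors -/

/-- Polynomial growth of `H` is too slow for the gap between `d` and a smaller `l`. -/
theorem le_of_forall_mul_le_mul_add {H : ℕ → ℕ} {t c d l : ℕ} (h1 : H 1 = 1)
    (hH : ∀ n, H n ≤ n ^ t) (h : ∀ n, d * H n ≤ l * H (n + c)) : d ≤ l := by
  have hpow : ∀ k, d ^ k ≤ l ^ k * H (1 + k * c) := by
    intro k
    induction k with
    | zero => simp [h1]
    | succ k ih =>
      calc d ^ (k + 1) = d * d ^ k := pow_succ' _ _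
        _ ≤ d * (l ^ k * H (1 + k * c)) := by gcongr
        _ = l ^ k * (d * H (1 + k * c)) := by ring
        _ ≤ l ^ k * (l * H (1 + k * c + c)) := Nat.mul_le_mul_left _ (h _)
        _ = l ^ (k + 1) * H (1 + (k + 1) * c) := by rw [pow_succ, mul_assoc]; congr 3; ring
  by_contra! hlt
  rcases Nat.eq_zero_or_pos l with rfl | hl
  · have h0 := hpow 1
    rw [pow_one, pow_one, zero_mul] at h0
    exact hlt.not_ge h0
  have hl' : (0 : ℝ) < l := by exact_mod_cast hl
  have hr : (1 : ℝ) < d / l := by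
    rw [one_lt_div hl']
    exact_mod_cast hlt
  have hlim := (tendsto_pow_const_div_const_pow_of_one_lt t hr).const_mul (((1 + c : ℕ) : ℝ) ^ t)
  rw [mul_zero] at hlim
  obtain ⟨k, hk, hk1⟩ := ((hlim.eventually (gt_mem_nhds one_pos)).and
    (Filter.eventually_ge_atTop 1)).exists
  rw [← mul_div_assoc, div_lt_one (by positivity), div_pow, lt_div_iff₀ (by positivity)] at hk
  refine hk.not_ge ?_
  have hle : d ^ k ≤ l ^ k * ((1 + c) * k) ^ t :=
    (hpow k).trans (Nat.mul_le_mul_left _ ((hH _).trans (Nat.pow_le_pow_left (by nlinarith) t)))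
  rw [← mul_pow, mul_comm]
  exact_mod_cast hle

theorem forGeneral_of_notMem_extMax {R : Type*} [CommRing R] [IsLocalRing R]
    [Infinite (IsLocalRing.ResidueField R)] {t : ℕ} {f : MvPolynomial (Fin t) R}
    (hf : f ∉ extMax R t) {P : (Fin t → R) → Prop}
    (h : ∀ α, IsUnit (MvPolynomial.eval α f) → P α) : ForGeneral P := by
  set g := MvPolynomial.map (IsLocalRing.residue R) f with hg
  have hg0 : g ≠ 0 := by
    intro h0
    refine hf (MvPolynomial.mem_map_C_iff.mpr fun x => ?_)
    rw [← IsLocalRing.residue_eq_zero_iff, ← MvPolynomial.coeff_map, ← hg, h0,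
      MvPolynomial.coeff_zero]
  refine ⟨{v | MvPolynomial.eval v g ≠ 0}, ?_, ?_, fun α hα => h α ?_⟩
  · refine ⟨Ideal.span {g}, ?_⟩
    ext v
    simp [MvPolynomial.zeroLocus_span, MvPolynomial.aeval_eq_eval]
  · let _ := zariskiTopology (IsLocalRing.ResidueField R) t
    rw [dense_iff_inter_open]
    rintro V ⟨I, hI⟩ ⟨v, hv⟩
    have hv' : v ∉ MvPolynomial.zeroLocus (IsLocalRing.ResidueField R) I := by
      rw [← hI]
      exact fun h => h hv
    rw [MvPolynomial.mem_zeroLocus_iff] at hv'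
    push Not at hv'
    obtain ⟨q, hq, hqv⟩ := hv'
    have hq0 : q ≠ 0 := by
      rintro rfl
      exact hqv (map_zero _)
    -- Over an infinite field the nonzero polynomial `q * g` has a nonzero value.
    obtain ⟨w, hw⟩ : ∃ w, MvPolynomial.eval w (q * g) ≠ 0 := by
      by_contra! hall
      exact mul_ne_zero hq0 hg0 (MvPolynomial.funext fun w => by rw [hall, map_zero])
    rw [map_mul] at hw
    refine ⟨w, ?_, right_ne_zero_of_mul hw⟩
    by_contra hwV
    have hwI : w ∈ MvPolynomial.zeroLocus (IsLocalRing.ResidueField R) I := hI ▸ hwV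
    exact left_ne_zero_of_mul hw (by simpa [MvPolynomial.aeval_eq_eval] using hwI q hq)
  · rw [← IsLocalRing.notMem_maximalIdeal, ← IsLocalRing.residue_eq_zero_iff]
    intro h0
    refine hα ?_
    rw [hg, MvPolynomial.eval_map, ← h0]
    exact (MvPolynomial.eval₂_comp_left (IsLocalRing.residue R) (RingHom.id R) α f).symm

/-! ### Specialization as reduction modulo the ideal of a point -/

section Specialization

variable {R : Type*} [CommRing R] {t : ℕ} {M : Type*} [AddCommGroup M] [Module R M]

theorem evalTensor_eq_zero_iff (α : Fin t → R) (x : MvPolynomial (Fin t) R ⊗[R] M) :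
    evalTensor M α x = 0 ↔ x ∈ RingHom.ker (MvPolynomial.eval α) •
      (⊤ : Submodule (MvPolynomial (Fin t) R) (MvPolynomial (Fin t) R ⊗[R] M)) := by
  constructor
  · intro h
    have := sub_evalTensor_mem α x
    rwa [h, TensorProduct.tmul_zero, sub_zero] at this
  · intro h
    refine Submodule.smul_induction_on h (fun p hp y _ => ?_) (fun x y hx hy => ?_)
    · rw [evalTensor_smul, RingHom.mem_ker.mp hp, zero_smul]
    · rw [map_add, hx, hy, add_zero]

theorem evalTensor_surjective (α : Fin t → R) : Function.Surjective (evalTensor M α) :=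
  fun m => ⟨1 ⊗ₜ m, by simp⟩

/-- `M ⧸ N'_α` is the reduction of `M' ⧸ N'` modulo the ideal of the point `α`. -/
theorem FreePresentation.length_quotient_specializedSubmodule
    {N' : Submodule (MvPolynomial (Fin t) R) (MvPolynomial (Fin t) R ⊗[R] M)}
    (φ : FreePresentation (MvPolynomial (Fin t) R) N') (α : Fin t → R) :
    Module.length R (M ⧸ φ.specializedSubmodule α) =
      Module.length R (((MvPolynomial (Fin t) R ⊗[R] M) ⧸ N') ⧸
        (RingHom.ker (MvPolynomial.eval α) • ⊤ : Submodule (MvPolynomial (Fin t) R)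
          ((MvPolynomial (Fin t) R ⊗[R] M) ⧸ N'))) := by
  rw [φ.specializedSubmodule_eq_map α]
  let K : Submodule (MvPolynomial (Fin t) R) ((MvPolynomial (Fin t) R ⊗[R] M) ⧸ N') :=
    RingHom.ker (MvPolynomial.eval α) • ⊤
  let f : MvPolynomial (Fin t) R ⊗[R] M →ₗ[R]
      M ⧸ (N'.restrictScalars R).map (evalTensor M α) := Submodule.mkQ _ ∘ₗ evalTensor M α
  let g : MvPolynomial (Fin t) R ⊗[R] M →ₗ[R] ((MvPolynomial (Fin t) R ⊗[R] M) ⧸ N') ⧸ K :=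
    (K.mkQ ∘ₗ N'.mkQ).restrictScalars R
  have hf : Function.Surjective f :=
    (Submodule.mkQ_surjective _).comp (evalTensor_surjective α)
  have hg : Function.Surjective g :=
    (Submodule.mkQ_surjective _).comp (Submodule.mkQ_surjective _)
  have hK : K = (RingHom.ker (MvPolynomial.eval α) • ⊤ : Submodule (MvPolynomial (Fin t) R)
      (MvPolynomial (Fin t) R ⊗[R] M)).map N'.mkQ := by
    rw [Submodule.map_smul'', Submodule.map_top, Submodule.range_mkQ]
  have hker : LinearMap.ker f = LinearMap.ker g := by
    ext x
    have hfx : x ∈ LinearMap.ker f ↔ ∃ y ∈ N', evalTensor M α y = evalTensor M α x := by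
      rw [LinearMap.mem_ker, LinearMap.comp_apply, Submodule.mkQ_apply,
        Submodule.Quotient.mk_eq_zero]
      rfl
    have hgx : x ∈ LinearMap.ker g ↔ N'.mkQ x ∈ K :=
      Submodule.Quotient.mk_eq_zero K
    rw [hfx, hgx, hK]
    constructor
    · rintro ⟨y, hy, hyx⟩
      refine ⟨x - y, (evalTensor_eq_zero_iff α _).mp (by rw [map_sub, hyx, sub_self]), ?_⟩
      rw [map_sub, sub_eq_self]
      exact (Submodule.Quotient.mk_eq_zero N').mpr hy
    · rintro ⟨z, hz, hzx⟩
      refine ⟨x - z, (Submodule.Quotient.eq N').mp hzx.symm, ?_⟩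
      rw [map_sub, (evalTensor_eq_zero_iff α _).mpr hz, sub_zero]
  exact (f.quotKerEquivOfSurjective hf).symm.length_eq.trans
    ((Submodule.quotEquivOfEq _ _ hker).trans (g.quotKerEquivOfSurjective hg)).length_eq

end Specialization

/-! ### Comparison of generic and special lengths -/

section LocalLength

variable {R : Type*} [CommRing R] [IsLocalRing R] {t : ℕ}
variable {Q : Type*} [AddCommGroup Q] [Module (MvPolynomial (Fin t) R) Q] [Module R Q]
  [IsScalarTower R (MvPolynomial (Fin t) R) Q]

/-- A filtration by copies of `k[z]` specializes to one by copies of `k[z] ⧸ I ^ n`. -/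
theorem HasPrimeFiltration.length_quotient_ker_eval_pow {d : ℕ}
    {P : Submodule (MvPolynomial (Fin t) R) Q} (h : HasPrimeFiltration (extMax R t) d P)
    (α : Fin t → R) (n : ℕ) :
    Module.length R (P ⧸ (RingHom.ker (MvPolynomial.eval α) ^ n • ⊤ :
      Submodule (MvPolynomial (Fin t) R) P)) = (d * (lowExponents t n).card : ℕ) := by
  rw [h.length_quotient_smul_top R (extMax_inf_ker_eval_pow_le α n),
    length_quotient_extMax_sup_ker_eval_pow, Nat.cast_mul]

/-- At a point where `f` does not vanish, `Q` may be replaced by the filtered submodule `P`. -/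
theorem HasPrimeFiltration.length_quotient_ker_eval {d : ℕ}
    {P : Submodule (MvPolynomial (Fin t) R) Q} (h : HasPrimeFiltration (extMax R t) d P)
    {f : MvPolynomial (Fin t) R} (hf : ∀ x : Q, f • x ∈ P) {α : Fin t → R}
    (hα : IsUnit (MvPolynomial.eval α f)) :
    Module.length R (Q ⧸ (RingHom.ker (MvPolynomial.eval α) • ⊤ :
      Submodule (MvPolynomial (Fin t) R) Q)) = d := by
  obtain ⟨c, hc⟩ := hα.exists_left_inv
  rw [length_quotient_smul_top_eq_of_smul_mem R (c := MvPolynomial.C c) hf (by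
    rw [RingHom.mem_ker, map_sub, map_mul, MvPolynomial.eval_C, hc, map_one, sub_self])]
  have := h.length_quotient_ker_eval_pow α 1
  rwa [pow_one, card_lowExponents_one, mul_one] at this

/-- The Hilbert–Samuel comparison: `Q ⧸ I ^ n Q` has length at most `λ(Q ⧸ I Q) * H n`, and, by the
Artin–Rees lemma, at least `d * H (n - c)`, where `H n` counts the monomials of degree less
than `n`. -/
theorem HasPrimeFiltration.le_length_quotient_ker_eval [IsNoetherianRing R]
    [Module.Finite (MvPolynomial (Fin t) R) Q] {d : ℕ}
    {P : Submodule (MvPolynomial (Fin t) R) Q} (h : HasPrimeFiltration (extMax R t) d P)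
    (α : Fin t → R) :
    d ≤ Module.length R (Q ⧸ (RingHom.ker (MvPolynomial.eval α) • ⊤ :
      Submodule (MvPolynomial (Fin t) R) Q)) := by
  classical
  obtain ⟨c, hc⟩ := exists_length_quotient_pow_smul_top_le R
    (RingHom.ker (MvPolynomial.eval α)) P
  have hub (n : ℕ) := length_quotient_pow_smul_top_le (Q := Q) R _ (ker_eval_pow_eq_span α) n
  generalize Module.length R (Q ⧸ (RingHom.ker (MvPolynomial.eval α) • ⊤ :
      Submodule (MvPolynomial (Fin t) R) Q)) = l at hub ⊢
  induction l with
  | top => exact le_top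
  | coe l =>
    rw [Nat.cast_le]
    refine le_of_forall_mul_le_mul_add (c := c) (card_lowExponents_one t)
      (card_lowExponents_le t) fun n => ?_
    have hlb := (hc n).trans (hub (n + c))
    rw [h.length_quotient_ker_eval_pow, ← Nat.cast_mul, Nat.cast_le, mul_comm _ l] at hlb
    refine hlb.trans (Nat.mul_le_mul_left l ?_)
    rw [card_lowExponents]
    exact Finset.sum_le_sum fun j _ => Finset.card_image_le

end LocalLength

end SpecializationLemma

theorem mainTheorem3
    {R : Type*} [CommRing R] [IsLocalRing R] [IsNoetherianRing R]
    [Infinite (IsLocalRing.ResidueField R)] (t : ℕ)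
    {M : Type*} [AddCommGroup M] [Module R M] [Module.Finite R M]
    (N' : Submodule (MvPolynomial (Fin t) R) (MvPolynomial (Fin t) R ⊗[R] M))
    (δ : ℕ)
    (hδ : localLength (extMax R t) N' = (δ : ℕ∞)) :
    (ForGeneral fun α : Fin t → R =>
      ∀ φ : FreePresentation (MvPolynomial (Fin t) R) N',
        Module.length R (M ⧸ φ.specializedSubmodule α) = (δ : ℕ∞)) ∧
    (ringChar R = ringChar (IsLocalRing.ResidueField R) →
      ∀ α₀ : Fin t → R, ForGeneral fun α : Fin t → R =>
        ∀ φ φ₀ : FreePresentation (MvPolynomial (Fin t) R) N',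
          (δ : ℕ∞) = Module.length R (M ⧸ φ.specializedSubmodule α) ∧
          Module.length R (M ⧸ φ.specializedSubmodule α) ≤
            Module.length R (M ⧸ φ₀.specializedSubmodule α₀)) := by
  rw [localLength, (localizedQuotientEquiv (extMax R t).primeCompl N').length_eq] at hδ
  obtain ⟨P, hP, f, hf, hfP⟩ := exists_hasPrimeFiltration (extMax R t) hδ
  have ha (α : Fin t → R) (hα : IsUnit (MvPolynomial.eval α f))
      (φ : FreePresentation (MvPolynomial (Fin t) R) N') :
      Module.length R (M ⧸ φ.specializedSubmodule α) = δ := by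
    rw [φ.length_quotient_specializedSubmodule, hP.length_quotient_ker_eval hfP hα]
  refine ⟨forGeneral_of_notMem_extMax hf ha, fun _ α₀ => forGeneral_of_notMem_extMax hf ?_⟩
  intro α hα φ φ₀
  rw [ha α hα, φ₀.length_quotient_specializedSubmodule]
  exact ⟨rfl, hP.le_length_quotient_ker_eval α₀⟩
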